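/- For a quasi-symmetric function $u$ in $x_1,x_2,\dots$ write $u(a_1,\dots,a_n)$ for its value at $x_i=a_i$ ($i\le n$), $x_i=0$ ($i>n$), and put $$\eta_2(u)=\sum_{m=1}^\infty \frac{u(1,\tfrac12,\dots,\tfrac1m)}{m^2}.$$ Let $e_k$ and $h_k$ be the elementary and complete symmetric functions of degree $k$. For positive integers $i_1,\dots,i_k$ with $i_1>1$ let $$\zeta(i_1,\dots,i_k)=\sum_{n_1>n_2>\cdots>n_k\ge 1}\frac1{n_1^{i_1}\cdots n_k^{i_k}}$$ be the multiple zeta value of weight $i_1+\dots+i_k$ and depth $k$. For $1\le k<N$ let $S^T_{N,k}$ be the sum of all multiple zeta values $\zeta(i_1,\dots,i_k)$ of weight $N$ and depth $k$ with $i_1>1$ and $i_1\neq 2$. Theorem. Let $n,j$ be integers with $0\le j\le n$. Then the series defining $\eta_2(e_jh_{n-j})$ converges, and $$\eta_2(e_jh_{n-j})=\begin{cases}(n+1)\,\zeta(n+2), & j=0,\\[2pt] \displaystyle\sum_{p=j}^n\binom{p-1}{j-1}S^T_{n+2,p}+\binom{n+1}{j+1}\zeta(n+2), & j\ge 1.\end{cases}$$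 -/

import Mathlib

namespace HFun

noncomputable section

open scoped Classical

/-! ### Quasi-symmetric functions

Formal power series in the countably many variables `x₁, x₂, …` are elements of
`MvPowerSeries ℕ ℚ`; the variable `x_{i+1}` carries the index `i`. -/

/-- A formal power series of bounded degree. -/
def IsBoundedDegree (u : MvPowerSeries ℕ ℚ) : Prop :=
  ∃ d : ℕ, ∀ m : ℕ →₀ ℕ, MvPowerSeries.coeff m u ≠ 0 → m.degree ≤ d

/-- For all `i₁ < ⋯ < i_k` and all exponents, the coefficient of `x_{i₁}^{a₁} ⋯ x_{i_k}^{a_k}`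
equals that of `x₁^{a₁} ⋯ x_k^{a_k}`.  (Zero exponents are allowed; this follows from the
condition for positive exponents by deleting the zeros on both sides.) -/
def IsQuasiSymmetric (u : MvPowerSeries ℕ ℚ) : Prop :=
  ∀ (k : ℕ) (f : Fin k ↪o ℕ) (a : Fin k →₀ ℕ),
    MvPowerSeries.coeff (a.embDomain f.toEmbedding) u =
      MvPowerSeries.coeff (a.embDomain Fin.valEmbedding) u

theorem isQuasiSymmetric_iff (u : MvPowerSeries ℕ ℚ) :
    IsQuasiSymmetric u ↔ ∀ (k : ℕ) (f : Fin k ↪o ℕ),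
      MvPowerSeries.killCompl (R := ℚ) f.toEmbedding u =
        MvPowerSeries.killCompl (R := ℚ) Fin.valEmbedding u := by
  unfold IsQuasiSymmetric
  refine forall_congr' fun k => forall_congr' fun f => ?_
  rw [MvPowerSeries.ext_iff]
  refine forall_congr' fun a => ?_
  rw [MvPowerSeries.coeff_killCompl, MvPowerSeries.coeff_killCompl]

theorem IsBoundedDegree.add {u v : MvPowerSeries ℕ ℚ} (hu : IsBoundedDegree u)
    (hv : IsBoundedDegree v) : IsBoundedDegree (u + v) := by
  obtain ⟨d, hd⟩ := hu
  obtain ⟨e, he⟩ := hv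
  refine ⟨max d e, fun m hm => ?_⟩
  by_contra! h
  have h1 : MvPowerSeries.coeff m u = 0 := by
    by_contra h'
    exact absurd (hd m h') (by omega)
  have h2 : MvPowerSeries.coeff m v = 0 := by
    by_contra h'
    exact absurd (he m h') (by omega)
  exact hm (by simp [h1, h2])

theorem IsBoundedDegree.mul {u v : MvPowerSeries ℕ ℚ} (hu : IsBoundedDegree u)
    (hv : IsBoundedDegree v) : IsBoundedDegree (u * v) := by
  obtain ⟨d, hd⟩ := hu
  obtain ⟨e, he⟩ := hv
  refine ⟨d + e, fun m hm => ?_⟩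
  rw [MvPowerSeries.coeff_mul] at hm
  obtain ⟨p, hp, hne⟩ := Finset.exists_ne_zero_of_sum_ne_zero hm
  have h1 := hd p.1 (left_ne_zero_of_mul hne)
  have h2 := he p.2 (right_ne_zero_of_mul hne)
  rw [Finset.HasAntidiagonal.mem_antidiagonal] at hp
  rw [← hp, map_add]
  omega

theorem isBoundedDegree_algebraMap (r : ℚ) :
    IsBoundedDegree (algebraMap ℚ (MvPowerSeries ℕ ℚ) r) := by
  refine ⟨0, fun m hm => ?_⟩
  by_contra h
  refine hm ?_
  rw [MvPowerSeries.algebraMap_apply, MvPowerSeries.coeff_C, if_neg]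
  rintro rfl
  simp at h

/-- The ring of quasi-symmetric functions. -/
def QSym : Subalgebra ℚ (MvPowerSeries ℕ ℚ) where
  carrier := {u | IsBoundedDegree u ∧ IsQuasiSymmetric u}
  add_mem' := by
    rintro u v ⟨hu, hu'⟩ ⟨hv, hv'⟩
    rw [isQuasiSymmetric_iff] at hu' hv'
    exact ⟨hu.add hv, (isQuasiSymmetric_iff _).2 fun k f => by
      rw [map_add, map_add, hu' k f, hv' k f]⟩
  mul_mem' := by
    rintro u v ⟨hu, hu'⟩ ⟨hv, hv'⟩
    rw [isQuasiSymmetric_iff] at hu' hv'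
    exact ⟨hu.mul hv, (isQuasiSymmetric_iff _).2 fun k f => by
      rw [map_mul, map_mul, hu' k f, hv' k f]⟩
  algebraMap_mem' r := ⟨isBoundedDegree_algebraMap r, (isQuasiSymmetric_iff _).2 fun k f => by
    rw [AlgHom.commutes, AlgHom.commutes]⟩

/-- The sum of all squarefree monomials of degree `k`. -/
def elemSeries (k : ℕ) : MvPowerSeries ℕ ℚ :=
  fun m => if m.degree = k ∧ ∀ i, m i ≤ 1 then 1 else 0

/-- The sum of all monomials of degree `k`. -/
def complSeries (k : ℕ) : MvPowerSeries ℕ ℚ :=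
  fun m => if m.degree = k then 1 else 0

theorem coeff_elemSeries (k : ℕ) (m : ℕ →₀ ℕ) : MvPowerSeries.coeff m (elemSeries k) =
    if m.degree = k ∧ ∀ i, m i ≤ 1 then 1 else 0 := rfl

theorem coeff_complSeries (k : ℕ) (m : ℕ →₀ ℕ) : MvPowerSeries.coeff m (complSeries k) =
    if m.degree = k then 1 else 0 := rfl

/-- The elementary symmetric function `e_k`. -/
def elemSym (k : ℕ) : QSym :=
  ⟨elemSeries k, by
    constructor
    · refine ⟨k, fun m hm => ?_⟩
      rw [coeff_elemSeries] at hm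
      exact (ite_ne_right_iff.1 hm).1.1.le
    · intro l f a
      have key : ∀ g : Fin l ↪ ℕ, (∀ i, a.embDomain g i ≤ 1) ↔ ∀ i, a i ≤ 1 := by
        intro g
        constructor
        · intro h i
          simpa using h (g i)
        · intro h i
          by_cases hi : i ∈ Set.range g
          · obtain ⟨i, rfl⟩ := hi
            simpa using h i
          · rw [Finsupp.embDomain_of_notMem_range _ _ _ hi]
            exact Nat.zero_le 1
      have deg : ∀ g : Fin l ↪ ℕ, (a.embDomain g).degree = a.degree := by
        intro g
        rw [Finsupp.embDomain_eq_mapDomain, Finsupp.degree_mapDomain]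
      simp only [coeff_elemSeries, key, deg]⟩

/-- The complete symmetric function `h_k`. -/
def complSym (k : ℕ) : QSym :=
  ⟨complSeries k, by
    constructor
    · refine ⟨k, fun m hm => ?_⟩
      rw [coeff_complSeries] at hm
      exact (ite_ne_right_iff.1 hm).1.le
    · intro l f a
      simp only [coeff_complSeries, Finsupp.embDomain_eq_mapDomain, Finsupp.degree_mapDomain]⟩

/-! ### Evaluation at finitely many reals -/

theorem killCompl_mem_range (n : ℕ) (u : QSym) :
    MvPowerSeries.killCompl (R := ℚ) (Fin.valEmbedding (n := n)) (u : MvPowerSeries ℕ ℚ) ∈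
      (MvPolynomial.coeToMvPowerSeries.algHom (σ := Fin n) (R := ℚ) ℚ).range := by
  obtain ⟨d, hd⟩ := u.2.1
  refine ⟨MvPowerSeries.truncTotal (d + 1) (MvPowerSeries.killCompl Fin.valEmbedding u.1), ?_⟩
  ext m
  have hc := MvPowerSeries.coeff_killCompl (e := Fin.valEmbedding (n := n)) u.1 m
  change MvPowerSeries.coeff m (MvPolynomial.coeToMvPowerSeries.algHom ℚ
    (MvPowerSeries.truncTotal (d + 1) (MvPowerSeries.killCompl Fin.valEmbedding u.1))) = _
  rw [MvPolynomial.coeToMvPowerSeries.algHom_apply, MvPowerSeries.coeff_map,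
    MvPolynomial.coeff_coe, MvPowerSeries.coeff_truncTotal_eq_ite]
  split_ifs with hm
  · rfl
  · by_contra hne
    have h1 := hd (m.embDomain Fin.valEmbedding) (by rw [← hc]; exact fun h0 => hne h0.symm)
    rw [Finsupp.embDomain_eq_mapDomain, Finsupp.degree_mapDomain] at h1
    omega

theorem coe_algHom_injective (n : ℕ) :
    Function.Injective (MvPolynomial.coeToMvPowerSeries.algHom (σ := Fin n) (R := ℚ) ℚ) := by
  intro p q hpq
  simpa [MvPolynomial.coeToMvPowerSeries.algHom_apply] using hpq

/-- The homomorphism that keeps `x₁, …, x_n` and sends `x_i` to `0` for `i > n`; by boundedness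
of the degree the result is a polynomial (see `coe_restrictVars`). -/
def restrictVars (n : ℕ) : QSym →ₐ[ℚ] MvPolynomial (Fin n) ℚ :=
  ((AlgEquiv.ofInjective _ (coe_algHom_injective n)).symm : _ →ₐ[ℚ] MvPolynomial (Fin n) ℚ).comp
    (((MvPowerSeries.killCompl (R := ℚ) (Fin.valEmbedding (n := n))).comp QSym.val).codRestrict
      _ (killCompl_mem_range n))

theorem coe_restrictVars (n : ℕ) (u : QSym) :
    (restrictVars n u : MvPowerSeries (Fin n) ℚ) =
      MvPowerSeries.killCompl (R := ℚ) Fin.valEmbedding (u : MvPowerSeries ℕ ℚ) := by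
  have h1 : MvPolynomial.coeToMvPowerSeries.algHom (σ := Fin n) (R := ℚ) ℚ (restrictVars n u) =
      MvPowerSeries.killCompl (R := ℚ) Fin.valEmbedding (u : MvPowerSeries ℕ ℚ) :=
    congrArg Subtype.val ((AlgEquiv.ofInjective _ (coe_algHom_injective n)).apply_symm_apply
      ⟨_, killCompl_mem_range n u⟩)
  rw [← h1]
  simp [MvPolynomial.coeToMvPowerSeries.algHom_apply]

/-- The homomorphism `u ↦ u(a₁, …, a_n)` sending `x_i` to `a_i` for `i ≤ n` and to `0` for
`i > n`. -/
def evalAt {n : ℕ} (a : Fin n → ℝ) : QSym →ₐ[ℚ] ℝ :=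
  (MvPolynomial.aeval a).comp (restrictVars n)

/-! ### `H`-functions -/

/-- The term with index `n ≥ 1` of the series defining `η_{s₁,…,s_k}(u)`, namely
`u(1, 1/2, …, 1/n) / (n^{s₁} (n+1)^{s₂} ⋯ (n+k-1)^{s_k})`. -/
def etaTerm (s : List ℕ) (u : QSym) (n : ℕ) : ℝ :=
  evalAt (fun i : Fin n => 1 / ((i : ℝ) + 1)) u /
    ∏ r : Fin s.length, ((n : ℝ) + (r : ℝ)) ^ s.get r

/-- The `H`-function `η_{s₁,…,s_k}`, the sum over `n ≥ 1` of `etaTerm`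
(for `s₁ + ⋯ + s_k ≥ 2`). -/
def eta (s : List ℕ) (u : QSym) : ℝ :=
  ∑' n : ℕ, etaTerm s u (n + 1)

/-! ### Multiple zeta values -/

/-- `ζ(i₁, …, i_k) = ∑_{n₁ > n₂ > ⋯ > n_k ≥ 1} 1 / (n₁^{i₁} ⋯ n_k^{i_k})`. -/
def mzv (I : List ℕ) : ℝ :=
  ∑' n : {n : Fin I.length → ℕ // StrictAnti n ∧ ∀ r, 1 ≤ n r},
    1 / ∏ r : Fin I.length, (n.1 r : ℝ) ^ I.get r

/-- `S^T_{n,k}`: the sum of all multiple zeta values `ζ(i₁, …, i_k)` of weight `n` and depth `k`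
with `i₁ > 1` and `i₁ ≠ 2`. -/
def ST (n k : ℕ) : ℝ :=
  ∑ c : Composition n with
      c.length = k ∧ ∃ i ∈ c.blocks.head?, 1 < i ∧ i ≠ 2, mzv c.blocks

end

end HFun

namespace HFun

open Finset

/-! Put `k = n - j` and write e_j(M), h_k(M) for the values at 1, 1/2, …, 1/M. For j ≥ 1 the
identity e_j(M+1) = e_j(M) + e_{j-1}(M)/(M+1) splits the term of η₂ with index M+1 into A = e_j(M)
h_k(M+1)/(M+1)² and B = e_{j-1}(M) h_k(M+1)/(M+1)³; for j = 0 only A occurs.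

The sum of A is found by a WZ argument. With t marking j and s marking k, A is the case K = 0 of
F(K,M) = (1+t)_M / ((M+1) (K+1-s)_{M+1}). Put G = (M+1) F and D = F(K,M) - F(K+1,M) = (1+t)_M /
(K+1-s)_{M+2}. Then (K+1-s-t) D = G(K,M) - G(K,M+1), so summing over M gives 1/((K+1-s)(K+1-s-t)),
whose coefficient at t^j s^k is C(n+1,j+1) (K+1)^{-(n+2)}. Summing over K gives C(n+1,j+1) ζ(n+2)
(`tsum_wzDiff`, `hasSum_wzTerm_zero`). Everything is carried out on coefficients.

The sum of B is the part with S^T. A monomial with p distinct variables has C(p,i) squarefree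
divisors of degree i, so e_i h_{w-i} is the sum of C(length,i) times the monomial quasi-symmetric
functions of weight w (`sum_choose_mul_multHarmonic`). The factor (M+1)^{-3} and the powers of
1/(M+1) in h_k(M+1) together form a first exponent of at least 3, which is the condition i₁ > 1, i₁
≠ 2 (`hasSum_sum_ST`). Bounds by powers of harmonic numbers give all convergence. -/

/-- The geometric series `∑ aᵏ Xᵏ`. -/
noncomputable def geomSeries (a : ℝ) : PowerSeries ℝ := PowerSeries.mk (fun k => a ^ k)

/-- The generating series of the elementary symmetric functions at `1, 1/2, …, 1/M`. -/
noncomputable def elemProd (M : ℕ) : PowerSeries ℝ :=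
  ∏ i ∈ range M, (1 + PowerSeries.C (1 / ((i : ℝ) + 1)) * PowerSeries.X)

/-- The generating series of the complete symmetric functions at
`1/(K+1), 1/(K+2), …, 1/(K+M)`. -/
noncomputable def complProd (K M : ℕ) : PowerSeries ℝ :=
  ∏ i ∈ range M, geomSeries (1 / ((K : ℝ) + i + 1))

/-- `e_j(1, 1/2, …, 1/M)`. -/
noncomputable def elemVal (M j : ℕ) : ℝ := PowerSeries.coeff j (elemProd M)

/-- `h_k(1/(K+1), …, 1/(K+M))`. -/
noncomputable def complVal (K M k : ℕ) : ℝ := PowerSeries.coeff k (complProd K M)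

/-! ### Evaluations at 1, 1/2, …, 1/M as coefficients of finite products. -/

theorem evalAt_eq_sum {n : ℕ} (a : Fin n → ℝ) (u : QSym) (k : ℕ)
    (hu : ∀ m : ℕ →₀ ℕ, m.degree ≠ k → MvPowerSeries.coeff m (u : MvPowerSeries ℕ ℚ) = 0) :
    evalAt a u = ∑ l ∈ finsuppAntidiag (univ : Finset (Fin n)) k,
      ((MvPowerSeries.coeff (l.embDomain Fin.valEmbedding) (u : MvPowerSeries ℕ ℚ) : ℚ) : ℝ) *
        ∏ i, a i ^ l i := by
  have hc : ∀ l : Fin n →₀ ℕ, MvPolynomial.coeff l (restrictVars n u) =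
      MvPowerSeries.coeff (l.embDomain Fin.valEmbedding) (u : MvPowerSeries ℕ ℚ) := by
    intro l
    rw [← MvPolynomial.coeff_coe, coe_restrictVars, MvPowerSeries.coeff_killCompl]
  change MvPolynomial.aeval a (restrictVars n u) = _
  rw [MvPolynomial.aeval_def, MvPolynomial.eval₂_eq']
  simp only [hc]
  -- By homogeneity only exponent vectors of degree `k` survive; this is the index set of
  -- `PowerSeries.coeff_prod`, so products of series can be compared termwise.
  refine Finset.sum_subset_zero_on_sdiff ?_ ?_ (fun _ _ => by simp)
  · intro l hl
    rw [MvPolynomial.mem_support_iff, hc] at hl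
    rw [mem_finsuppAntidiag]
    refine ⟨?_, subset_univ _⟩
    by_contra h
    refine hl (hu _ ?_)
    rwa [Finsupp.embDomain_eq_mapDomain, Finsupp.degree_mapDomain, Finsupp.degree_eq_sum]
  · intro l hl
    rw [mem_sdiff, MvPolynomial.mem_support_iff, hc, not_not] at hl
    rw [hl.2]
    simp

theorem degree_embDomain_of_mem {n k : ℕ} {l : Fin n →₀ ℕ}
    (hl : l ∈ finsuppAntidiag (univ : Finset (Fin n)) k) :
    (l.embDomain Fin.valEmbedding).degree = k := by
  rw [mem_finsuppAntidiag] at hl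
  rw [Finsupp.embDomain_eq_mapDomain, Finsupp.degree_mapDomain, Finsupp.degree_eq_sum]
  exact hl.1

theorem evalAt_complSym (M k : ℕ) :
    evalAt (fun i : Fin M => 1 / ((i : ℝ) + 1)) (complSym k) = complVal 0 M k := by
  rw [evalAt_eq_sum _ _ k (fun m hm => (coeff_complSeries k m).trans (if_neg hm)), complVal,
    complProd, ← Fin.prod_univ_eq_prod_range
      (fun i => geomSeries (1 / (((0 : ℕ) : ℝ) + (i : ℝ) + 1))), PowerSeries.coeff_prod]
  refine sum_congr rfl fun l hl => ?_
  have h1 : MvPowerSeries.coeff (l.embDomain Fin.valEmbedding)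
      (complSym k : MvPowerSeries ℕ ℚ) = 1 :=
    (coeff_complSeries k _).trans (if_pos (degree_embDomain_of_mem hl))
  rw [h1]
  simp [geomSeries]

theorem coeff_one_add_C_mul_X (a : ℝ) (l : ℕ) :
    PowerSeries.coeff l (1 + PowerSeries.C a * PowerSeries.X) = if l ≤ 1 then a ^ l else 0 := by
  rcases l with _ | _ | l
  · simp
  · simp [PowerSeries.coeff_one]
  · simp [PowerSeries.coeff_one]

open scoped Classical in
theorem evalAt_elemSym (M j : ℕ) :
    evalAt (fun i : Fin M => 1 / ((i : ℝ) + 1)) (elemSym j) = elemVal M j := by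
  rw [evalAt_eq_sum _ _ j (fun m hm => (coeff_elemSeries j m).trans (if_neg fun h => hm h.1)),
    elemVal, elemProd, ← Fin.prod_univ_eq_prod_range
      (fun i => 1 + PowerSeries.C (1 / ((i : ℝ) + 1)) * PowerSeries.X), PowerSeries.coeff_prod]
  refine sum_congr rfl fun l hl => ?_
  have h1 : MvPowerSeries.coeff (l.embDomain Fin.valEmbedding)
      (elemSym j : MvPowerSeries ℕ ℚ) = if ∀ i, l i ≤ 1 then 1 else 0 := by
    have hiff : (∀ i, l.embDomain Fin.valEmbedding i ≤ 1) ↔ ∀ i, l i ≤ 1 := by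
      refine ⟨fun h i => ?_, fun h i => ?_⟩
      · exact (Finsupp.embDomain_apply_self Fin.valEmbedding l i).symm.trans_le (h _)
      · by_cases hi : i ∈ Set.range (Fin.valEmbedding (n := M))
        · obtain ⟨i, rfl⟩ := hi
          exact (Finsupp.embDomain_apply_self Fin.valEmbedding l i).trans_le (h i)
        · rw [Finsupp.embDomain_of_notMem_range _ _ _ hi]
          exact Nat.zero_le 1
    refine (coeff_elemSeries j _).trans ?_
    simp only [hiff, degree_embDomain_of_mem hl, true_and]
  rw [h1]
  simp only [coeff_one_add_C_mul_X]
  split_ifs with h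
  · simp [h]
  · push Not at h
    obtain ⟨i, hi⟩ := h
    rw [Rat.cast_zero, zero_mul, Finset.prod_eq_zero (mem_univ i)]
    rw [if_neg (by omega)]

theorem etaTerm_two_elemSym_mul_complSym (j k M : ℕ) :
    etaTerm [2] (elemSym j * complSym k) (M + 1) =
      elemVal (M + 1) j * complVal 0 (M + 1) k / ((M : ℝ) + 1) ^ 2 := by
  rw [etaTerm, map_mul, evalAt_elemSym, evalAt_complSym]
  simp

/-! ### Recursions -/

/-- The sequence `0, f 0, f 1, …`. -/
def shiftSeq (f : ℕ → ℝ) : ℕ → ℝ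
  | 0 => 0
  | k + 1 => f k

theorem geomSeries_mul (a : ℝ) :
    geomSeries a = 1 + PowerSeries.C a * PowerSeries.X * geomSeries a := by
  ext (_ | k)
  · simp [geomSeries]
  · rw [mul_assoc, map_add, PowerSeries.coeff_C_mul, PowerSeries.coeff_succ_X_mul]
    simp [geomSeries, PowerSeries.coeff_one, pow_succ']

/-- From 1/(1-aX) = 1 + aX/(1-aX). The product occurs on both sides, one degree lower on the right,
so arguments based on this recursion need an induction on the degree as well. -/
theorem coeff_geomSeries_mul (a : ℝ) (f : PowerSeries ℝ) (k : ℕ) :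
    PowerSeries.coeff k (geomSeries a * f) = PowerSeries.coeff k f +
      a * shiftSeq (fun i => PowerSeries.coeff i (geomSeries a * f)) k := by
  have h : geomSeries a * f = f + PowerSeries.C a * (PowerSeries.X * (geomSeries a * f)) := by
    conv_lhs => rw [geomSeries_mul]
    ring
  conv_lhs => rw [h]
  rw [map_add, PowerSeries.coeff_C_mul]
  cases k with
  | zero => simp [shiftSeq]
  | succ k => rw [PowerSeries.coeff_succ_X_mul]; rfl

theorem complProd_succ (K M : ℕ) :
    complProd K (M + 1) = geomSeries (1 / ((K : ℝ) + M + 1)) * complProd K M := by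
  rw [complProd, prod_range_succ, mul_comm]; rfl

theorem complProd_succ' (K M : ℕ) :
    complProd K (M + 1) = geomSeries (1 / ((K : ℝ) + 1)) * complProd (K + 1) M := by
  rw [complProd, prod_range_succ', mul_comm, complProd]
  simp only [Nat.cast_zero, add_zero, Nat.cast_add, Nat.cast_one]
  congr 1
  refine prod_congr rfl fun i _ => ?_
  congr 3
  ring

theorem complVal_succ (K M k : ℕ) : complVal K (M + 1) k =
    complVal K M k + 1 / ((K : ℝ) + M + 1) * shiftSeq (complVal K (M + 1)) k := by
  have := coeff_geomSeries_mul (1 / ((K : ℝ) + M + 1)) (complProd K M) k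
  rwa [← complProd_succ] at this

theorem complVal_succ' (K M k : ℕ) : complVal K (M + 1) k =
    complVal (K + 1) M k + 1 / ((K : ℝ) + 1) * shiftSeq (complVal K (M + 1)) k := by
  have := coeff_geomSeries_mul (1 / ((K : ℝ) + 1)) (complProd (K + 1) M) k
  rwa [← complProd_succ'] at this

theorem elemVal_succ (M j : ℕ) : elemVal (M + 1) j =
    elemVal M j + 1 / ((M : ℝ) + 1) * shiftSeq (elemVal M) j := by
  have h : elemProd (M + 1) = elemProd M +
      PowerSeries.C (1 / ((M : ℝ) + 1)) * (PowerSeries.X * elemProd M) := by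
    rw [elemProd, prod_range_succ, ← elemProd]; ring
  rw [elemVal, h, map_add, PowerSeries.coeff_C_mul]
  cases j with
  | zero => simp [shiftSeq, elemVal]
  | succ k => rw [PowerSeries.coeff_succ_X_mul]; rfl

theorem elemVal_zero (j : ℕ) : elemVal 0 j = if j = 0 then 1 else 0 := by
  simp [elemVal, elemProd, PowerSeries.coeff_one]

theorem complVal_zero (K k : ℕ) : complVal K 0 k = if k = 0 then 1 else 0 := by
  simp [complVal, complProd, PowerSeries.coeff_one]

theorem complVal_one (K k : ℕ) : complVal K 1 k = (1 / ((K : ℝ) + 1)) ^ k := by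
  simp [complVal, complProd, geomSeries]

theorem shiftSeq_nonneg {f : ℕ → ℝ} (hf : ∀ k, 0 ≤ f k) (k : ℕ) : 0 ≤ shiftSeq f k := by
  cases k with
  | zero => exact le_rfl
  | succ k => exact hf k

theorem elemVal_nonneg (M j : ℕ) : 0 ≤ elemVal M j := by
  induction M generalizing j with
  | zero => rw [elemVal_zero]; split_ifs <;> norm_num
  | succ M ih =>
    rw [elemVal_succ]
    have := shiftSeq_nonneg ih j
    have := ih j
    positivity

theorem complVal_nonneg (K M k : ℕ) : 0 ≤ complVal K M k := by
  induction M generalizing k with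
  | zero => rw [complVal_zero]; split_ifs <;> norm_num
  | succ M ih =>
    induction k with
    | zero =>
      rw [complVal_succ]
      simpa [shiftSeq] using ih 0
    | succ k ihk =>
      rw [complVal_succ]
      have := ih (k + 1)
      simp only [shiftSeq]
      positivity

theorem complVal_le (K M k : ℕ) : complVal K M k ≤ complVal 0 M k := by
  induction M generalizing k with
  | zero => rw [complVal_zero, complVal_zero]
  | succ M ih =>
    induction k with
    | zero =>
      rw [complVal_succ, complVal_succ 0]
      simpa [shiftSeq] using ih 0
    | succ k ihk =>
      rw [complVal_succ, complVal_succ 0]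
      refine add_le_add (ih _) (mul_le_mul ?_ ihk (complVal_nonneg _ _ _) (by positivity))
      gcongr
      simp

/-! ### Growth -/

theorem harmonic_succ_real (M : ℕ) :
    ((harmonic (M + 1) : ℚ) : ℝ) = (harmonic M : ℝ) + 1 / ((M : ℝ) + 1) := by
  rw [harmonic_succ]; push_cast; simp

theorem harmonic_real_nonneg (M : ℕ) : (0 : ℝ) ≤ (harmonic M : ℝ) := by
  induction M with
  | zero => simp
  | succ M ih => rw [harmonic_succ_real]; positivity

theorem elemVal_le_harmonic_pow (M j : ℕ) : elemVal M j ≤ (harmonic M : ℝ) ^ j := by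
  induction M generalizing j with
  | zero => cases j <;> simp [elemVal_zero]
  | succ M ih =>
    have h0 := harmonic_real_nonneg M
    have h1 := harmonic_succ_real M
    have hz : (0 : ℝ) ≤ 1 / ((M : ℝ) + 1) := by positivity
    rw [elemVal_succ]
    cases j with
    | zero => simpa [shiftSeq] using ih 0
    | succ j =>
      calc elemVal M (j + 1) + 1 / ((M : ℝ) + 1) * elemVal M j
          ≤ (harmonic M : ℝ) ^ (j + 1) + 1 / ((M : ℝ) + 1) * (harmonic M : ℝ) ^ j :=
            add_le_add (ih _) (mul_le_mul_of_nonneg_left (ih _) hz)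
        _ = (harmonic M : ℝ) ^ j * (harmonic (M + 1) : ℝ) := by rw [h1]; ring
        _ ≤ (harmonic (M + 1) : ℝ) ^ j * (harmonic (M + 1) : ℝ) := by
            refine mul_le_mul_of_nonneg_right (pow_le_pow_left₀ h0 (by rw [h1]; linarith) _)
              (harmonic_real_nonneg _)
        _ = _ := by ring

theorem complVal_le_harmonic_pow (M k : ℕ) : complVal 0 M k ≤ (harmonic M : ℝ) ^ k := by
  induction M generalizing k with
  | zero => cases k <;> simp [complVal_zero]
  | succ M ih =>
    have h0 := harmonic_real_nonneg M
    have h1 := harmonic_succ_real M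
    have hz : (0 : ℝ) ≤ 1 / ((M : ℝ) + 1) := by positivity
    have h2 : (harmonic M : ℝ) ≤ (harmonic (M + 1) : ℝ) := by rw [h1]; linarith
    induction k with
    | zero =>
      rw [complVal_succ]
      simpa [shiftSeq] using ih 0
    | succ k ihk =>
      rw [complVal_succ]
      simp only [shiftSeq, Nat.cast_zero, zero_add]
      calc complVal 0 M (k + 1) + 1 / ((M : ℝ) + 1) * complVal 0 (M + 1) k
          ≤ (harmonic M : ℝ) ^ k * (harmonic M : ℝ) +
              1 / ((M : ℝ) + 1) * (harmonic (M + 1) : ℝ) ^ k :=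
            add_le_add ((ih _).trans_eq (pow_succ _ _)) (mul_le_mul_of_nonneg_left ihk hz)
        _ ≤ (harmonic (M + 1) : ℝ) ^ k * (harmonic M : ℝ) +
              1 / ((M : ℝ) + 1) * (harmonic (M + 1) : ℝ) ^ k := by gcongr
        _ = _ := by rw [pow_succ, h1]; ring

/-- The exponent 1/2 serves two purposes: after division by (M+1)² the bound is summable, and after
division by M+1 it tends to 0. -/
theorem exists_harmonic_pow_le (n : ℕ) : ∃ C : ℝ, 0 ≤ C ∧
    ∀ M : ℕ, (harmonic (M + 1) : ℝ) ^ n ≤ C * ((M : ℝ) + 1) ^ (1 / 2 : ℝ) := by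
  -- Chosen so that ε n ≤ 1/2; the logarithm is bounded by x^ε/ε.
  set ε : ℝ := 1 / (2 * (n + 1)) with hε
  have hε0 : 0 < ε := by positivity
  refine ⟨(1 + 1 / ε) ^ n, by positivity, fun M => ?_⟩
  have hx : (1 : ℝ) ≤ (M : ℝ) + 1 := by linarith [(Nat.cast_nonneg M : (0 : ℝ) ≤ M)]
  have h1 : (harmonic (M + 1) : ℝ) ≤ (1 + 1 / ε) * ((M : ℝ) + 1) ^ ε := by
    have a := harmonic_le_one_add_log (M + 1)
    have b := Real.log_le_rpow_div (x := (M : ℝ) + 1) (by linarith) hε0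
    have c := Real.one_le_rpow hx hε0.le
    push_cast at a
    calc _ ≤ _ := a
      _ ≤ ((M : ℝ) + 1) ^ ε + ((M : ℝ) + 1) ^ ε / ε := add_le_add c b
      _ = _ := by ring
  calc (harmonic (M + 1) : ℝ) ^ n ≤ ((1 + 1 / ε) * ((M : ℝ) + 1) ^ ε) ^ n :=
        pow_le_pow_left₀ (harmonic_real_nonneg _) h1 _
    _ = (1 + 1 / ε) ^ n * ((M : ℝ) + 1) ^ (ε * n) := by
        rw [mul_pow, Real.rpow_mul (by linarith), Real.rpow_natCast]
    _ ≤ _ := by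
        refine mul_le_mul_of_nonneg_left (Real.rpow_le_rpow_of_exponent_le hx ?_) (by positivity)
        rw [hε, div_mul_eq_mul_div, one_mul, div_le_div_iff₀ (by positivity) (by norm_num)]
        linarith

theorem summable_harmonic_pow_div (n : ℕ) :
    Summable fun M : ℕ => (harmonic (M + 1) : ℝ) ^ n / ((M : ℝ) + 1) ^ 2 := by
  obtain ⟨C, hC, h⟩ := exists_harmonic_pow_le n
  have hs : Summable fun M : ℕ => C * (((M + 1 : ℕ) : ℝ) ^ (-(3 / 2) : ℝ)) :=
    ((summable_nat_add_iff 1).2 (Real.summable_nat_rpow.2 (by norm_num))).mul_left C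
  refine hs.of_nonneg_of_le (fun M => ?_) fun M => ?_
  · have := harmonic_real_nonneg (M + 1)
    positivity
  · have hx : (0 : ℝ) < (M : ℝ) + 1 := by positivity
    rw [div_le_iff₀ (by positivity)]
    refine (h M).trans_eq ?_
    push_cast
    rw [mul_assoc, ← Real.rpow_natCast, ← Real.rpow_add hx]
    norm_num

theorem tendsto_harmonic_pow_div (n : ℕ) :
    Filter.Tendsto (fun M : ℕ => (harmonic (M + 1) : ℝ) ^ n / ((M : ℝ) + 1)) Filter.atTop
      (nhds 0) := by
  obtain ⟨C, hC, h⟩ := exists_harmonic_pow_le n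
  have ht : Filter.Tendsto (fun M : ℕ => C * (((M + 1 : ℕ) : ℝ) ^ (-(1 / 2) : ℝ))) Filter.atTop
      (nhds (C * 0)) :=
    (((tendsto_rpow_neg_atTop (by norm_num : (0 : ℝ) < 1 / 2)).comp
      tendsto_natCast_atTop_atTop).comp (Filter.tendsto_add_atTop_nat 1)).const_mul C
  rw [mul_zero] at ht
  refine squeeze_zero (fun M => ?_) (fun M => ?_) ht
  · have := harmonic_real_nonneg (M + 1)
    positivity
  · have hx : (0 : ℝ) < (M : ℝ) + 1 := by positivity
    rw [div_le_iff₀ (by positivity)]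
    refine (h M).trans_eq ?_
    push_cast
    rw [mul_assoc, ← Real.rpow_add_one hx.ne']
    norm_num

theorem elemVal_mul_complVal_le (M j k : ℕ) :
    elemVal M j * complVal 0 (M + 1) k ≤ (harmonic (M + 1) : ℝ) ^ (j + k) := by
  rw [pow_add]
  have h0 := harmonic_real_nonneg M
  have h1 := harmonic_succ_real M
  have h2 : (harmonic M : ℝ) ≤ (harmonic (M + 1) : ℝ) := by
    rw [h1]
    have : (0 : ℝ) ≤ 1 / ((M : ℝ) + 1) := by positivity
    linarith
  exact mul_le_mul ((elemVal_le_harmonic_pow M j).trans (pow_le_pow_left₀ h0 h2 _))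
    (complVal_le_harmonic_pow _ _) (complVal_nonneg _ _ _) (pow_nonneg (h0.trans h2) _)

/-! ### A WZ pair -/

/-- `1 / ((K+1)(K+2)⋯(K+M))`. -/
noncomputable def invProd (K M : ℕ) : ℝ := ∏ i ∈ range M, 1 / ((K : ℝ) + i + 1)

theorem invProd_succ (K M : ℕ) : invProd K (M + 1) = invProd K M * (1 / ((K : ℝ) + M + 1)) :=
  prod_range_succ _ _

theorem invProd_succ' (K M : ℕ) :
    invProd K (M + 1) = invProd (K + 1) M * (1 / ((K : ℝ) + 1)) := by
  rw [invProd, prod_range_succ', invProd]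
  simp only [Nat.cast_zero, add_zero, Nat.cast_add, Nat.cast_one]
  congr 1
  refine prod_congr rfl fun i _ => ?_
  congr 1
  ring

theorem invProd_nonneg (K M : ℕ) : 0 ≤ invProd K M :=
  prod_nonneg fun i _ => by positivity

theorem invProd_le (K M : ℕ) : invProd K M ≤ invProd 0 M := by
  refine prod_le_prod (fun i _ => by positivity) fun i _ => ?_
  gcongr
  simp

theorem invProd_succ_le (K M : ℕ) :
    invProd K (M + 1) ≤ invProd 0 (M + 1) * (1 / ((K : ℝ) + 1)) := by
  rw [invProd_succ' K, invProd_succ' 0]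
  refine mul_le_mul_of_nonneg_right ?_ (by positivity)
  simp only [Nat.cast_zero, zero_add, div_one, mul_one]
  refine prod_le_prod (fun i _ => by positivity) fun i _ => ?_
  gcongr
  simp

theorem factorial_mul_invProd (M : ℕ) :
    (M.factorial : ℝ) * invProd 0 (M + 1) = 1 / ((M : ℝ) + 1) := by
  induction M with
  | zero => simp [invProd]
  | succ M ih =>
    rw [invProd_succ, Nat.factorial_succ]
    push_cast
    rw [show ((M : ℝ) + 1) * M.factorial * (invProd 0 (M + 1) * (1 / (0 + ((M : ℝ) + 1) + 1))) =
      ((M.factorial : ℝ) * invProd 0 (M + 1)) * (((M : ℝ) + 1) / (0 + ((M : ℝ) + 1) + 1)) by ring,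
      ih, zero_add]
    field_simp

/-- Coefficient form of 1/(K+1-s)_M - 1/(K+2-s)_M = M/(K+1-s)_{M+1}. The two recursions of
`complVal` express multiplication by the last factor K+M+1-s and by the first factor K+1-s. -/
theorem invProd_mul_complVal_sub (K M k : ℕ) :
    invProd K M * complVal K M k - invProd (K + 1) M * complVal (K + 1) M k =
      M * (invProd K (M + 1) * complVal K (M + 1) k) := by
  have h1 : invProd K M = invProd K (M + 1) * ((K : ℝ) + M + 1) := by
    rw [invProd_succ]; field_simp
  have h2 : invProd (K + 1) M = invProd K (M + 1) * ((K : ℝ) + 1) := by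
    rw [invProd_succ']; field_simp
  rw [eq_sub_of_add_eq (complVal_succ K M k).symm, eq_sub_of_add_eq (complVal_succ' K M k).symm,
    h1, h2]
  field_simp
  ring

/-- The coefficients of `(1+t)_M / (K+1-s)_{M+1}`. -/
noncomputable def wzFlux (K M j k : ℕ) : ℝ :=
  M.factorial * invProd K (M + 1) * elemVal M j * complVal K (M + 1) k

/-- The coefficients of `(1+t)_M / ((M+1) (K+1-s)_{M+1})`. -/
noncomputable def wzTerm (K M j k : ℕ) : ℝ := wzFlux K M j k / ((M : ℝ) + 1)

/-- The coefficients of `(1+t)_M / (K+1-s)_{M+2}`. -/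
noncomputable def wzDiff (K M j k : ℕ) : ℝ :=
  M.factorial * elemVal M j * (invProd K (M + 2) * complVal K (M + 2) k)

theorem wzTerm_sub_wzTerm (K M j k : ℕ) :
    wzTerm K M j k - wzTerm (K + 1) M j k = wzDiff K M j k := by
  have h := invProd_mul_complVal_sub K (M + 1) k
  have hM : ((M : ℝ) + 1) ≠ 0 := by positivity
  push_cast at h
  rw [wzTerm, wzTerm, wzFlux, wzFlux, wzDiff, ← sub_div, div_eq_iff hM]
  linear_combination (M.factorial : ℝ) * elemVal M j * h

/-- Coefficient form of (K+1-s-t) D = G(K,M) - G(K,M+1): over the common denominator (K+1-s)_{M+2}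
the numerators differ by (K+M+2-s) - (M+1+t). The two shifts are multiplication by s and by t. -/
theorem wzDiff_recursion (K M j k : ℕ) :
    ((K : ℝ) + 1) * wzDiff K M j k - shiftSeq (wzDiff K M j) k -
      shiftSeq (fun j => wzDiff K M j k) j = wzFlux K M j k - wzFlux K (M + 1) j k := by
  have e1 : shiftSeq (wzDiff K M j) k =
      M.factorial * elemVal M j * (invProd K (M + 2) * shiftSeq (complVal K (M + 2)) k) := by
    cases k <;> simp [shiftSeq, wzDiff]
  have e2 : shiftSeq (fun j => wzDiff K M j k) j =
      M.factorial * shiftSeq (elemVal M) j * (invProd K (M + 2) * complVal K (M + 2) k) := by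
    cases j <;> simp [shiftSeq, wzDiff]
  have h1 : invProd K (M + 1) = invProd K (M + 2) * ((K : ℝ) + M + 2) := by
    rw [invProd_succ K (M + 1)]; push_cast; field_simp; ring
  have h3 := eq_sub_of_add_eq (complVal_succ K (M + 1) k).symm
  push_cast at h3
  have hK : ((K : ℝ) + (M + 1) + 1) ≠ 0 := by positivity
  rw [e1, e2, wzFlux, wzFlux, wzDiff, elemVal_succ, h3, h1, Nat.factorial_succ]
  push_cast
  field_simp
  ring

theorem wzFlux_nonneg (K M j k : ℕ) : 0 ≤ wzFlux K M j k := by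
  have := invProd_nonneg K (M + 1)
  have := elemVal_nonneg M j
  have := complVal_nonneg K (M + 1) k
  rw [wzFlux]
  positivity

theorem wzTerm_nonneg (K M j k : ℕ) : 0 ≤ wzTerm K M j k :=
  div_nonneg (wzFlux_nonneg K M j k) (by positivity)

theorem wzFlux_zero_left (M j k : ℕ) :
    wzFlux 0 M j k = elemVal M j * complVal 0 (M + 1) k / ((M : ℝ) + 1) := by
  rw [wzFlux, factorial_mul_invProd]; ring

theorem wzTerm_zero_left (M j k : ℕ) :
    wzTerm 0 M j k = elemVal M j * complVal 0 (M + 1) k / ((M : ℝ) + 1) ^ 2 := by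
  rw [wzTerm, wzFlux_zero_left, div_div, sq]

theorem wzFlux_le (K M j k : ℕ) : wzFlux K M j k ≤ wzFlux 0 M j k := by
  have := elemVal_nonneg M j
  have := complVal_nonneg K (M + 1) k
  have := invProd_nonneg 0 (M + 1)
  rw [wzFlux, wzFlux]
  gcongr
  · exact invProd_le _ _
  · exact complVal_le _ _ _

/-- The decay in `K` comes from the first factor 1/(K+1) alone. It gives summability in `M` for
every `K`, and later the vanishing of the remainder as `K` grows. -/
theorem wzTerm_le (K M j k : ℕ) :
    wzTerm K M j k ≤ wzTerm 0 M j k * (1 / ((K : ℝ) + 1)) := by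
  have := elemVal_nonneg M j
  have := complVal_nonneg K (M + 1) k
  have := invProd_nonneg 0 (M + 1)
  rw [wzTerm, wzTerm, wzFlux, wzFlux, div_mul_eq_mul_div]
  refine div_le_div_of_nonneg_right ?_ (by positivity)
  calc _ ≤ (M.factorial : ℝ) * (invProd 0 (M + 1) * (1 / ((K : ℝ) + 1))) * elemVal M j *
        complVal 0 (M + 1) k := by
        gcongr
        · exact invProd_succ_le _ _
        · exact complVal_le _ _ _
    _ = _ := by ring

theorem tendsto_wzFlux (K j k : ℕ) :
    Filter.Tendsto (fun M => wzFlux K M j k) Filter.atTop (nhds 0) := by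
  refine squeeze_zero (fun M => wzFlux_nonneg _ _ _ _) (fun M => ?_)
    (tendsto_harmonic_pow_div (j + k))
  refine (wzFlux_le K M j k).trans ?_
  rw [wzFlux_zero_left]
  exact div_le_div_of_nonneg_right (elemVal_mul_complVal_le M j k) (by positivity)

theorem summable_wzTerm_zero (j k : ℕ) : Summable fun M => wzTerm 0 M j k := by
  refine (summable_harmonic_pow_div (j + k)).of_nonneg_of_le
    (fun M => wzTerm_nonneg _ _ _ _) fun M => ?_
  rw [wzTerm_zero_left]
  exact div_le_div_of_nonneg_right (elemVal_mul_complVal_le M j k) (by positivity)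

theorem summable_wzTerm (K j k : ℕ) : Summable fun M => wzTerm K M j k :=
  ((summable_wzTerm_zero j k).mul_right _).of_nonneg_of_le
    (fun _ => wzTerm_nonneg _ _ _ _) fun M => wzTerm_le K M j k

theorem summable_wzDiff (K j k : ℕ) : Summable fun M => wzDiff K M j k :=
  ((summable_wzTerm K j k).sub (summable_wzTerm (K + 1) j k)).congr fun M =>
    wzTerm_sub_wzTerm K M j k

theorem hasSum_shiftSeq {f : ℕ → ℕ → ℝ} (hf : ∀ k, Summable fun M => f M k) (k : ℕ) :
    HasSum (fun M => shiftSeq (f M) k) (shiftSeq (fun k => ∑' M, f M k) k) := by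
  cases k with
  | zero => exact hasSum_zero
  | succ k => exact (hf k).hasSum

theorem tsum_wzDiff_recursion (K j k : ℕ) :
    ((K : ℝ) + 1) * (∑' M, wzDiff K M j k) - shiftSeq (fun k => ∑' M, wzDiff K M j k) k -
      shiftSeq (fun j => ∑' M, wzDiff K M j k) j = wzFlux K 0 j k := by
  have h1 := (((summable_wzDiff K j k).hasSum.mul_left ((K : ℝ) + 1)).sub
    (hasSum_shiftSeq (f := fun M k => wzDiff K M j k) (fun k => summable_wzDiff K j k) k)).sub
    (hasSum_shiftSeq (f := fun M j => wzDiff K M j k) (fun j => summable_wzDiff K j k) j)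
  have h2 := h1.tendsto_sum_nat
  have h3 : ∀ N, ∑ M ∈ range N, (((K : ℝ) + 1) * wzDiff K M j k - shiftSeq (wzDiff K M j) k -
      shiftSeq (fun j => wzDiff K M j k) j) = wzFlux K 0 j k - wzFlux K N j k := by
    intro N
    simp only [wzDiff_recursion]
    exact sum_range_sub' (fun M => wzFlux K M j k) N
  simp only [h3] at h2
  refine tendsto_nhds_unique h2 ?_
  simpa using (tendsto_wzFlux K j k).const_sub (wzFlux K 0 j k)

theorem wzFlux_zero (K j k : ℕ) :
    wzFlux K 0 j k = if j = 0 then (1 / ((K : ℝ) + 1)) ^ (k + 1) else 0 := by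
  rw [wzFlux, elemVal_zero, complVal_one, invProd]
  split_ifs <;> simp [pow_succ, mul_comm]

/-- The telescoped recursion determines the coefficients of 1/((K+1-s)(K+1-s-t)) from those of lower
degree in s or t; the induction step is Pascal's rule. -/
theorem tsum_wzDiff (K j k : ℕ) : ∑' M, wzDiff K M j k =
    ((j + k + 1).choose (j + 1) : ℕ) * (1 / ((K : ℝ) + 1)) ^ (j + k + 2) := by
  have hz : 1 / ((K : ℝ) + 1) * ((K : ℝ) + 1) = 1 := one_div_mul_cancel (by positivity)
  have hrec := tsum_wzDiff_recursion K
  simp only [wzFlux_zero] at hrec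
  -- Only z(K+1) = 1 matters from here on: multiplying the recursion by z solves it for the new
  -- coefficient.
  generalize 1 / ((K : ℝ) + 1) = z at hz hrec ⊢
  induction j generalizing k with
  | zero =>
    induction k with
    | zero =>
      have h := hrec 0 0
      simp only [shiftSeq, sub_zero, if_true] at h
      simp only [zero_add, Nat.choose_self]
      push_cast
      linear_combination z * h - (∑' M, wzDiff K M 0 0) * hz
    | succ k ih =>
      have h := hrec 0 (k + 1)
      simp only [shiftSeq, sub_zero, if_true, ih] at h
      simp only [zero_add, Nat.choose_one_right] at h ⊢
      push_cast at h ⊢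
      linear_combination z * h - (∑' M, wzDiff K M 0 (k + 1)) * hz
  | succ j ihj =>
    induction k with
    | zero =>
      have h := hrec (j + 1) 0
      simp only [shiftSeq, sub_zero, Nat.succ_ne_zero, if_false, ihj] at h
      simp only [add_zero, Nat.choose_self] at h ⊢
      push_cast at h ⊢
      linear_combination z * h - (∑' M, wzDiff K M (j + 1) 0) * hz
    | succ k ih =>
      have h := hrec (j + 1) (k + 1)
      simp only [shiftSeq, Nat.succ_ne_zero, if_false, ihj, ih] at h
      have hc : ((j + 1 + (k + 1) + 1).choose (j + 1 + 1) : ℝ) =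
          (j + (k + 1) + 1).choose (j + 1) + (j + 1 + k + 1).choose (j + 1 + 1) := by
        rw [show j + 1 + (k + 1) + 1 = (j + (k + 1) + 1) + 1 by ring, Nat.choose_succ_succ,
          show j + 1 + k + 1 = j + (k + 1) + 1 by ring]
        push_cast
        rfl
      rw [hc]
      linear_combination z * h - (∑' M, wzDiff K M (j + 1) (k + 1)) * hz

theorem hasSum_wzTerm_zero (j k : ℕ) : HasSum (fun M => wzTerm 0 M j k)
    (((j + k + 1).choose (j + 1) : ℕ) * ∑' M : ℕ, (1 / ((M : ℝ) + 1)) ^ (j + k + 2)) := by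
  have hz : Summable fun M : ℕ => (1 / ((M : ℝ) + 1)) ^ (j + k + 2) := by
    have := (summable_nat_add_iff 1).2
      (Real.summable_one_div_nat_pow.2 (by omega : 1 < j + k + 2))
    simpa [div_pow] using this
  -- Telescoping in `K`: the sum over `M` at `K = 0` equals the first `N` differences plus a
  -- remainder, which is O(1/(N+1)) by `wzTerm_le`.
  have hS : ∀ N, ∑' M, wzTerm 0 M j k = ∑ K ∈ range N,
      (((j + k + 1).choose (j + 1) : ℕ) : ℝ) * (1 / ((K : ℝ) + 1)) ^ (j + k + 2) +
        ∑' M, wzTerm N M j k := by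
    intro N
    induction N with
    | zero => simp
    | succ N ih =>
      have hstep : ∑' M, wzTerm N M j k =
          ∑' M, wzDiff N M j k + ∑' M, wzTerm (N + 1) M j k := by
        rw [← (summable_wzDiff N j k).tsum_add (summable_wzTerm (N + 1) j k)]
        exact tsum_congr fun M => by rw [← wzTerm_sub_wzTerm]; ring
      rw [ih, sum_range_succ, ← tsum_wzDiff N, hstep]
      ring
  have h0 : Filter.Tendsto (fun N => ∑' M, wzTerm N M j k) Filter.atTop (nhds 0) := by
    have ht := tendsto_one_div_add_atTop_nhds_zero_nat (𝕜 := ℝ) |>.const_mul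
      (∑' M, wzTerm 0 M j k)
    rw [mul_zero] at ht
    refine squeeze_zero (fun N => tsum_nonneg fun M => wzTerm_nonneg _ _ _ _) (fun N => ?_) ht
    rw [← tsum_mul_right]
    exact (summable_wzTerm N j k).tsum_le_tsum (wzTerm_le N · j k)
      ((summable_wzTerm_zero j k).mul_right _)
  have h1 := ((hz.mul_left ((j + k + 1).choose (j + 1) : ℝ)).hasSum.tendsto_sum_nat).add h0
  simp only [← hS, add_zero] at h1
  rw [tsum_mul_left] at h1
  rw [← tendsto_nhds_unique tendsto_const_nhds h1]
  exact (summable_wzTerm_zero j k).hasSum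

/-! ### Multiple zeta values as iterated sums -/

/-- The multiple harmonic sum `∑_{M ≥ n₁ > ⋯ > n_k ≥ 1} 1 / (n₁^{i₁} ⋯ n_k^{i_k})`. -/
noncomputable def multHarmonic : List ℕ → ℕ → ℝ
  | [], _ => 1
  | c :: cs, M => ∑ i ∈ range M, (1 / ((i : ℝ) + 1)) ^ c * multHarmonic cs i

theorem multHarmonic_nonneg (I : List ℕ) (M : ℕ) : 0 ≤ multHarmonic I M := by
  induction I generalizing M with
  | nil => exact zero_le_one
  | cons c cs ih => exact sum_nonneg fun i _ => mul_nonneg (by positivity) (ih i)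

theorem multHarmonic_cons_succ (c : ℕ) (cs : List ℕ) (M : ℕ) :
    multHarmonic (c :: cs) (M + 1) =
      multHarmonic (c :: cs) M + (1 / ((M : ℝ) + 1)) ^ c * multHarmonic cs M :=
  sum_range_succ _ _

/-- The strictly decreasing sequences of positive integers in `s`. -/
abbrev DecreasingIn (l : ℕ) (s : Set ℕ) : Type :=
  {n : Fin l → ℕ // StrictAnti n ∧ ∀ r, 1 ≤ n r ∧ n r ∈ s}

/-- Splitting off the first entry of a strictly decreasing sequence. -/
noncomputable def decreasingConsEquiv (l : ℕ) {s : Set ℕ} (hs : IsLowerSet s) :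
    (Σ i : {i : ℕ | i + 1 ∈ s}, DecreasingIn l (Set.Iic (i : ℕ))) ≃ DecreasingIn (l + 1) s :=
  Equiv.ofBijective
    (fun x => ⟨Fin.cons ((x.1 : ℕ) + 1) x.2.1, by
      obtain ⟨⟨i, hi⟩, t, ht, ht'⟩ := x
      constructor
      · intro a b hab
        induction b using Fin.cases with
        | zero => exact absurd hab (Fin.not_lt_zero a)
        | succ b =>
          induction a using Fin.cases with
          | zero =>
            simp only [Fin.cons_zero, Fin.cons_succ]
            exact Nat.lt_succ_of_le (ht' b).2
          | succ a =>
            simp only [Fin.cons_succ]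
            exact ht (Fin.succ_lt_succ_iff.1 hab)
      · intro r
        induction r using Fin.cases with
        | zero => exact ⟨Nat.succ_pos _, hi⟩
        | succ r =>
          simp only [Fin.cons_succ]
          exact ⟨(ht' r).1, hs ((ht' r).2.trans (Nat.le_succ i)) hi⟩⟩)
    (by
      constructor
      · rintro ⟨⟨i, hi⟩, t, ht⟩ ⟨⟨i', hi'⟩, t', ht''⟩ h
        have h := congrArg Subtype.val h
        simp only [Fin.cons_inj, Nat.add_right_cancel_iff] at h
        obtain ⟨rfl, rfl⟩ := h
        rfl
      · rintro ⟨n, hn, hn'⟩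
        have h0 := (hn' 0).1
        have h1 : n 0 - 1 + 1 = n 0 := Nat.sub_add_cancel h0
        refine ⟨⟨⟨n 0 - 1, ?_⟩, Fin.tail n, ?_, fun r => ⟨(hn' r.succ).1, ?_⟩⟩, ?_⟩
        · change n 0 - 1 + 1 ∈ s
          rw [h1]
          exact (hn' 0).2
        · exact fun a b hab => hn (Fin.succ_lt_succ_iff.2 hab)
        · exact Nat.le_sub_one_of_lt (hn (Fin.succ_pos r))
        · refine Subtype.ext ?_
          change Fin.cons (n 0 - 1 + 1) (Fin.tail n) = n
          rw [h1, Fin.cons_self_tail])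

/-- With first entry i+1, the tail runs over decreasing sequences in `Set.Iic i`. A general lower
set `s` covers both truncated sums (`Set.Iic M`) and full multiple zeta values (`Set.univ`). -/
theorem hasSum_decreasing_cons (c : ℕ) (cs : List ℕ) {s : Set ℕ} (hs : IsLowerSet s)
    (htail : ∀ M, HasSum (fun n : DecreasingIn cs.length (Set.Iic M) =>
      1 / ∏ r : Fin cs.length, (n.1 r : ℝ) ^ cs.get r) (multHarmonic cs M)) {a : ℝ}
    (h : HasSum (fun i : {i : ℕ | i + 1 ∈ s} =>
      (1 / (((i : ℕ) : ℝ) + 1)) ^ c * multHarmonic cs i) a) :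
    HasSum (fun n : DecreasingIn (c :: cs).length s =>
      1 / ∏ r : Fin (c :: cs).length, (n.1 r : ℝ) ^ (c :: cs).get r) a := by
  refine ((decreasingConsEquiv cs.length hs).hasSum_iff).1 ?_
  have hterm : ∀ x : Σ i : {i : ℕ | i + 1 ∈ s}, DecreasingIn cs.length (Set.Iic (i : ℕ)),
      1 / ∏ r : Fin (c :: cs).length,
        (((decreasingConsEquiv cs.length hs x).1 r : ℕ) : ℝ) ^ (c :: cs).get r =
      (1 / (((x.1 : ℕ) : ℝ) + 1)) ^ c * (1 / ∏ r : Fin cs.length, (x.2.1 r : ℝ) ^ cs.get r) := by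
    intro x
    have := Fin.prod_univ_succ (n := cs.length) fun r =>
      (((decreasingConsEquiv cs.length hs x).1 r : ℕ) : ℝ) ^ (c :: cs).get r
    refine (congrArg (1 / ·) this).trans ?_
    change 1 / ((((x.1 : ℕ) + 1 : ℕ) : ℝ) ^ c * ∏ r : Fin cs.length, (x.2.1 r : ℝ) ^ cs.get r) = _
    rw [div_pow, one_pow, div_mul_div_comm, one_mul, Nat.cast_succ]
  have hnn : ∀ x : Σ i : {i : ℕ | i + 1 ∈ s}, DecreasingIn cs.length (Set.Iic (i : ℕ)), (0 : ℝ) ≤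
      (1 / (((x.1 : ℕ) : ℝ) + 1)) ^ c * (1 / ∏ r : Fin cs.length, (x.2.1 r : ℝ) ^ cs.get r) :=
    fun x => by positivity
  have hfib := fun i : {i : ℕ | i + 1 ∈ s} =>
    (htail i).mul_left ((1 / (((i : ℕ) : ℝ) + 1)) ^ c)
  refine HasSum.sigma_of_hasSum h (fun i => (hfib i).congr_fun fun n => hterm ⟨i, n⟩) ?_
  refine Summable.congr ?_ fun x => (hterm x).symm
  rw [summable_sigma_of_nonneg hnn]
  refine ⟨fun i => (hfib i).summable, ?_⟩
  simpa only [(hfib _).tsum_eq] using h.summable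

theorem hasSum_multHarmonic (I : List ℕ) (M : ℕ) :
    HasSum (fun n : DecreasingIn I.length (Set.Iic M) =>
      1 / ∏ r : Fin I.length, (n.1 r : ℝ) ^ I.get r) (multHarmonic I M) := by
  induction I generalizing M with
  | nil =>
    have : Unique (DecreasingIn ([] : List ℕ).length (Set.Iic M)) :=
      { default := ⟨Fin.elim0, fun a => a.elim0, fun r => r.elim0⟩
        uniq := fun n => Subtype.ext (funext fun r => r.elim0) }
    convert hasSum_unique (fun n : DecreasingIn ([] : List ℕ).length (Set.Iic M) =>
      1 / ∏ r : Fin ([] : List ℕ).length, (n.1 r : ℝ) ^ ([] : List ℕ).get r)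
    simp [multHarmonic]
  | cons c cs ih =>
    refine hasSum_decreasing_cons c cs (isLowerSet_Iic M) ih ?_
    refine (hasSum_subtype_iff_indicator
      (f := fun i : ℕ => (1 / ((i : ℝ) + 1)) ^ c * multHarmonic cs i)).2 ?_
    have h : multHarmonic (c :: cs) M = ∑ i ∈ range M,
        Set.indicator {i : ℕ | i + 1 ∈ Set.Iic M}
          (fun i : ℕ => (1 / ((i : ℝ) + 1)) ^ c * multHarmonic cs i) i :=
      sum_congr rfl fun i hi => (Set.indicator_of_mem (s := {i : ℕ | i + 1 ∈ Set.Iic M})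
        (f := fun i : ℕ => (1 / ((i : ℝ) + 1)) ^ c * multHarmonic cs i) (mem_range.1 hi)).symm
    rw [h]
    refine hasSum_sum_of_ne_finset_zero fun i hi => Set.indicator_of_notMem ?_ _
    exact fun h' => hi (mem_range.2 h')

theorem hasSum_mzv_cons (c : ℕ) (cs : List ℕ)
    (h : Summable fun M : ℕ => (1 / ((M : ℝ) + 1)) ^ c * multHarmonic cs M) :
    HasSum (fun M : ℕ => (1 / ((M : ℝ) + 1)) ^ c * multHarmonic cs M) (mzv (c :: cs)) := by
  have h1 := hasSum_decreasing_cons c cs isLowerSet_univ (hasSum_multHarmonic cs)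
    ((hasSum_subtype_iff_indicator
      (f := fun i : ℕ => (1 / ((i : ℝ) + 1)) ^ c * multHarmonic cs i)
      (s := {i : ℕ | i + 1 ∈ Set.univ})).2 (by
        rw [show {i : ℕ | i + 1 ∈ Set.univ} = Set.univ from rfl, Set.indicator_univ]
        exact h.hasSum))
  have h2 := (Equiv.hasSum_iff (Equiv.subtypeEquivRight (p := fun n : Fin (c :: cs).length → ℕ =>
    StrictAnti n ∧ ∀ r, 1 ≤ n r) (fun n => by simp))).2 h1
  have h3 : mzv (c :: cs) = ∑' M : ℕ, (1 / ((M : ℝ) + 1)) ^ c * multHarmonic cs M := h2.tsum_eq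
  rw [h3]
  exact h.hasSum

theorem mzv_singleton {c : ℕ} (hc : 1 < c) :
    mzv [c] = ∑' M : ℕ, (1 / ((M : ℝ) + 1)) ^ c := by
  have hz : Summable fun M : ℕ => (1 / ((M : ℝ) + 1)) ^ c := by
    have := (summable_nat_add_iff 1).2 (Real.summable_one_div_nat_pow.2 hc)
    simpa [div_pow] using this
  have h := (hasSum_mzv_cons c [] (by simpa [multHarmonic] using hz)).tsum_eq
  rw [← h]
  simp [multHarmonic]

/-! ### Sums over compositions -/

/-- The lists of positive integers with sum `w`. -/
noncomputable def compositionLists (w : ℕ) : Finset (List ℕ) :=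
  (univ : Finset (Composition w)).image Composition.blocks

theorem mem_compositionLists {w : ℕ} {l : List ℕ} :
    l ∈ compositionLists w ↔ l.sum = w ∧ ∀ i ∈ l, 0 < i := by
  simp only [compositionLists, mem_image, mem_univ, true_and]
  constructor
  · rintro ⟨c, rfl⟩
    exact ⟨c.blocks_sum, fun i hi => c.blocks_pos hi⟩
  · rintro ⟨h1, h2⟩
    exact ⟨⟨l, fun {i} hi => h2 i hi, h1⟩, rfl⟩

theorem sum_compositionLists (w : ℕ) (F : List ℕ → ℝ) :
    ∑ l ∈ compositionLists w, F l = ∑ c : Composition w, F c.blocks :=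
  sum_image fun _ _ _ _ h => Composition.ext h

theorem compositionLists_zero : compositionLists 0 = {[]} := by
  ext l
  rw [mem_compositionLists, mem_singleton]
  constructor
  · rintro ⟨h1, h2⟩
    cases l with
    | nil => rfl
    | cons a l =>
      have := h2 a (by simp)
      simp at h1
      omega
  · rintro rfl
    simp

theorem sum_compositionLists_succ (w : ℕ) (F : List ℕ → ℝ) :
    ∑ l ∈ compositionLists (w + 1), F l =
      ∑ p ∈ antidiagonal w, ∑ cs ∈ compositionLists p.2, F ((p.1 + 1) :: cs) := by
  rw [sum_sigma']
  symm
  refine sum_bij (fun x _ => (x.1.1 + 1) :: x.2) ?_ ?_ ?_ (fun _ _ => rfl)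
  · rintro ⟨⟨a, b⟩, cs⟩ h
    simp only [mem_sigma, HasAntidiagonal.mem_antidiagonal, mem_compositionLists] at h ⊢
    obtain ⟨h1, h2, h3⟩ := h
    refine ⟨by rw [List.sum_cons]; omega, ?_⟩
    simpa using h3
  · rintro ⟨⟨a, b⟩, cs⟩ h ⟨⟨a', b'⟩, cs'⟩ h' heq
    simp only [mem_sigma, HasAntidiagonal.mem_antidiagonal] at h h'
    simp only [List.cons.injEq, Nat.add_right_cancel_iff] at heq
    obtain ⟨rfl, rfl⟩ := heq
    obtain rfl : b = b' := by omega
    rfl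
  · intro l hl
    rw [mem_compositionLists] at hl
    obtain ⟨h1, h2⟩ := hl
    cases l with
    | nil => simp at h1
    | cons a cs =>
      have ha := h2 a (by simp)
      rw [List.sum_cons] at h1
      refine ⟨⟨(a - 1, cs.sum), cs⟩, ?_, ?_⟩
      · simp only [mem_sigma, HasAntidiagonal.mem_antidiagonal, mem_compositionLists]
        exact ⟨by omega, trivial, fun i hi => h2 i (by simp [hi])⟩
      · simp only [List.cons.injEq, and_true]
        omega

/-! ### Products e_j h_k as sums of monomial quasi-symmetric functions. -/

theorem elemVal_zero_right (M : ℕ) : elemVal M 0 = 1 := by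
  induction M with
  | zero => simp [elemVal_zero]
  | succ M ih => rw [elemVal_succ, ih]; simp [shiftSeq]

theorem complVal_zero_right (K M : ℕ) : complVal K M 0 = 1 := by
  induction M with
  | zero => simp [complVal_zero]
  | succ M ih => rw [complVal_succ, ih]; simp [shiftSeq]

theorem sum_antidiagonal_pow_mul_coeff (a : ℝ) (f : PowerSeries ℝ) (w : ℕ) :
    ∑ p ∈ antidiagonal w, a ^ p.1 * PowerSeries.coeff p.2 f =
      PowerSeries.coeff w (geomSeries a * f) := by
  rw [PowerSeries.coeff_mul]
  simp [geomSeries]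

theorem sum_choose_mul_multHarmonic_zero (j M : ℕ) :
    ∑ l ∈ compositionLists 0, (l.length.choose j : ℝ) * multHarmonic l M =
      elemVal M j * PowerSeries.coeff 0 (PowerSeries.X ^ j * complProd 0 M) := by
  rw [compositionLists_zero, sum_singleton]
  cases j with
  | zero =>
    have := complVal_zero_right 0 M
    rw [complVal] at this
    simp [multHarmonic, elemVal_zero_right, this, -PowerSeries.coeff_zero_eq_constantCoeff]
  | succ j => simp [multHarmonic]

/-- `e_j h_{w-j}` is the sum of `(length choose j)` times the monomial quasi-symmetric function
over all compositions of `w`. -/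
theorem sum_choose_mul_multHarmonic (w j M : ℕ) :
    ∑ l ∈ compositionLists w, (l.length.choose j : ℝ) * multHarmonic l M =
      elemVal M j * PowerSeries.coeff w (PowerSeries.X ^ j * complProd 0 M) := by
  -- Because of the factor X^j both sides vanish for j > w, so no truncated subtraction w - j
  -- enters. The induction adjoins the variable 1/(M+1), which has the largest index and can only be
  -- carried by the head of a list.
  induction M generalizing w j with
  | zero =>
    rcases w with _ | w
    · exact sum_choose_mul_multHarmonic_zero j 0
    have : complProd 0 0 = 1 := by simp [complProd]
    rw [sum_compositionLists_succ, elemVal_zero, this]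
    cases j <;> simp [multHarmonic, PowerSeries.coeff_one]
  | succ M ih =>
    rcases w with _ | w
    · exact sum_choose_mul_multHarmonic_zero j (M + 1)
    have hfirst := ih (w + 1) j
    rw [sum_compositionLists_succ] at hfirst ⊢
    simp only [multHarmonic_cons_succ, mul_add, sum_add_distrib, hfirst]
    have hz : ∀ i, ∑ p ∈ antidiagonal w, ∑ cs ∈ compositionLists p.2, (cs.length.choose i : ℝ) *
        ((1 / ((M : ℝ) + 1)) ^ (p.1 + 1) * multHarmonic cs M) = 1 / ((M : ℝ) + 1) * (elemVal M i *
          PowerSeries.coeff w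
            (geomSeries (1 / ((M : ℝ) + 1)) * (PowerSeries.X ^ i * complProd 0 M))) := by
      intro i
      rw [← sum_antidiagonal_pow_mul_coeff, mul_sum, mul_sum]
      refine sum_congr rfl fun p _ => ?_
      have h : ∑ cs ∈ compositionLists p.2, (cs.length.choose i : ℝ) *
          ((1 / ((M : ℝ) + 1)) ^ (p.1 + 1) * multHarmonic cs M) =
          (1 / ((M : ℝ) + 1)) ^ (p.1 + 1) *
            ∑ cs ∈ compositionLists p.2, (cs.length.choose i : ℝ) * multHarmonic cs M := by
        rw [mul_sum]
        exact sum_congr rfl fun _ _ => by ring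
      rw [h, ih]
      ring
    have hR : ∀ i, PowerSeries.X ^ i * complProd 0 (M + 1) =
        geomSeries (1 / ((M : ℝ) + 1)) * (PowerSeries.X ^ i * complProd 0 M) := by
      intro i
      rw [complProd_succ, Nat.cast_zero, zero_add]
      ring
    rw [hR, coeff_geomSeries_mul, elemVal_succ]
    simp only [shiftSeq]
    cases j with
    | zero =>
      have h0 := hz 0
      simp only [List.length_cons, Nat.choose_zero_right] at h0 ⊢
      rw [h0]
      ring
    | succ j =>
      -- Pascal's rule for the length of `c :: cs` mirrors the recursion of e_{j+1}: the new
      -- variable either belongs to the chosen squarefree divisor or does not.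
      simp only [List.length_cons, Nat.choose_succ_succ, Nat.cast_add, add_mul, sum_add_distrib,
        Nat.succ_eq_add_one, hz]
      have hX : PowerSeries.coeff (w + 1) (PowerSeries.X ^ (j + 1) * complProd 0 M) +
          1 / ((M : ℝ) + 1) * PowerSeries.coeff w
            (geomSeries (1 / ((M : ℝ) + 1)) * (PowerSeries.X ^ (j + 1) * complProd 0 M)) =
          PowerSeries.coeff w
            (geomSeries (1 / ((M : ℝ) + 1)) * (PowerSeries.X ^ j * complProd 0 M)) := by
        have h1 := coeff_geomSeries_mul (1 / ((M : ℝ) + 1))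
          (PowerSeries.X ^ (j + 1) * complProd 0 M) (w + 1)
        simp only [shiftSeq] at h1
        rw [← h1, ← PowerSeries.coeff_succ_X_mul w]
        congr 1
        ring
      linear_combination (1 / ((M : ℝ) + 1) * elemVal M j) * (-hX)

/-- By the case j = 0 of `sum_choose_mul_multHarmonic`, h_w is the sum of all monomial
quasi-symmetric functions of weight w, and each value is nonnegative. -/
theorem multHarmonic_le {w : ℕ} {l : List ℕ} (hl : l ∈ compositionLists w) (M : ℕ) :
    multHarmonic l M ≤ complVal 0 M w := by
  have h := sum_choose_mul_multHarmonic w 0 M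
  simp only [Nat.choose_zero_right, Nat.cast_one, one_mul, elemVal_zero_right, pow_zero] at h
  rw [complVal, ← h]
  exact single_le_sum (f := fun l => multHarmonic l M) (fun l _ => multHarmonic_nonneg l M) hl

theorem hasSum_mzv {w : ℕ} {cs : List ℕ} (hcs : cs ∈ compositionLists w) {c : ℕ} (hc : 2 ≤ c) :
    HasSum (fun M : ℕ => (1 / ((M : ℝ) + 1)) ^ c * multHarmonic cs M) (mzv (c :: cs)) := by
  refine hasSum_mzv_cons c cs ((summable_harmonic_pow_div w).of_nonneg_of_le
    (fun M => mul_nonneg (by positivity) (multHarmonic_nonneg cs M)) fun M => ?_)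
  have hM : 1 / ((M : ℝ) + 1) ≤ 1 :=
    (div_le_one (by positivity)).2 (by linarith [(Nat.cast_nonneg M : (0 : ℝ) ≤ M)])
  have h0 := harmonic_real_nonneg M
  calc (1 / ((M : ℝ) + 1)) ^ c * multHarmonic cs M
      ≤ (1 / ((M : ℝ) + 1)) ^ 2 * (harmonic (M + 1) : ℝ) ^ w := by
        refine mul_le_mul (pow_le_pow_of_le_one (by positivity) hM hc) ?_
          (multHarmonic_nonneg cs M) (by positivity)
        refine ((multHarmonic_le hcs M).trans (complVal_le_harmonic_pow M w)).trans
          (pow_le_pow_left₀ h0 ?_ _)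
        rw [harmonic_succ_real]
        have : (0 : ℝ) ≤ 1 / ((M : ℝ) + 1) := by positivity
        linarith
    _ = _ := by rw [div_pow, one_pow]; ring

/-! ### The sums S^T as single series. -/

open scoped Classical in
theorem sum_choose_mul_ST (i n : ℕ) :
    ∑ p ∈ Icc (i + 1) n, (((p - 1).choose i : ℕ) : ℝ) * ST (n + 2) p =
      ∑ l ∈ compositionLists (n + 2), if ∃ a ∈ l.head?, 1 < a ∧ a ≠ 2 then
        (((l.length - 1).choose i : ℕ) : ℝ) * mzv l else 0 := by
  rw [sum_compositionLists]
  simp only [ST, sum_filter, mul_sum]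
  rw [sum_comm]
  refine sum_congr rfl fun c _ => ?_
  by_cases hQ : ∃ a ∈ c.blocks.head?, 1 < a ∧ a ≠ 2
  · have h1 : ∀ p ∈ Icc (i + 1) n, ((((p - 1).choose i : ℕ) : ℝ) *
        if c.length = p ∧ ∃ a ∈ c.blocks.head?, 1 < a ∧ a ≠ 2 then mzv c.blocks else 0) =
        if c.length = p then (((c.length - 1).choose i : ℕ) : ℝ) * mzv c.blocks else 0 := by
      intro p _
      by_cases hp : c.length = p
      · rw [if_pos ⟨hp, hQ⟩, if_pos hp, hp]
      · rw [if_neg fun h => hp h.1, if_neg hp, mul_zero]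
    rw [if_pos hQ, sum_congr rfl h1, sum_ite_eq]
    split_ifs with hmem
    · rfl
    -- A first entry of at least 3 in weight n+2 forces length at most n, so a length outside the
    -- range is at most i and its binomial coefficient vanishes.
    · have hlen : 1 ≤ c.length ∧ c.length ≤ n := by
        obtain ⟨a, ha, ha1, ha2⟩ := hQ
        have hs := c.blocks_sum
        have hpos : ∀ i ∈ c.blocks, 1 ≤ i := fun i hi => c.blocks_pos hi
        change 1 ≤ c.blocks.length ∧ c.blocks.length ≤ n
        rcases hb : c.blocks with _ | ⟨b, cs⟩
        · simp [hb] at ha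
        · rw [hb] at ha hs hpos
          simp only [List.head?_cons, Option.mem_def, Option.some.injEq] at ha
          have h2 := List.length_le_sum_of_one_le cs fun i hi => hpos i (by simp [hi])
          rw [List.sum_cons] at hs
          rw [List.length_cons]
          omega
      have hblocks : c.length = c.blocks.length := rfl
      rw [mem_Icc] at hmem
      rw [Nat.choose_eq_zero_of_lt (by omega), Nat.cast_zero, zero_mul]
  · rw [if_neg hQ]
    exact sum_eq_zero fun p _ => by rw [if_neg fun h => hQ h.2, mul_zero]

theorem sum_choose_mul_ST_eq (i k : ℕ) :
    ∑ p ∈ Icc (i + 1) (i + 1 + k), (((p - 1).choose i : ℕ) : ℝ) * ST (i + 1 + k + 2) p =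
      ∑ p ∈ antidiagonal (i + k), ∑ cs ∈ compositionLists p.2,
        (cs.length.choose i : ℝ) * mzv ((p.1 + 3) :: cs) := by
  -- Peeling off two terms of the antidiagonal removes the first entries 1 and 2, which the
  -- condition excludes; the remaining first entries are `p.1 + 3`.
  rw [sum_choose_mul_ST, sum_compositionLists_succ, show i + 1 + k + 1 = (i + k) + 1 + 1 by ring,
    Nat.sum_antidiagonal_succ, Nat.sum_antidiagonal_succ]
  simp

theorem hasSum_sum_ST (i k : ℕ) :
    HasSum (fun M : ℕ => (1 / ((M : ℝ) + 1)) ^ 3 * (elemVal M i * complVal 0 (M + 1) k))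
      (∑ p ∈ Icc (i + 1) (i + 1 + k), (((p - 1).choose i : ℕ) : ℝ) * ST (i + 1 + k + 2) p) := by
  rw [sum_choose_mul_ST_eq]
  have h : HasSum (fun M : ℕ => ∑ p ∈ antidiagonal (i + k), ∑ cs ∈ compositionLists p.2,
      (cs.length.choose i : ℝ) * ((1 / ((M : ℝ) + 1)) ^ (p.1 + 3) * multHarmonic cs M))
      (∑ p ∈ antidiagonal (i + k), ∑ cs ∈ compositionLists p.2,
        (cs.length.choose i : ℝ) * mzv ((p.1 + 3) :: cs)) :=
    hasSum_sum fun p _ => hasSum_sum fun cs hcs => (hasSum_mzv hcs (by omega)).mul_left _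
  refine h.congr_fun fun M => ?_
  have h1 : ∀ p ∈ antidiagonal (i + k), ∑ cs ∈ compositionLists p.2,
      (cs.length.choose i : ℝ) * ((1 / ((M : ℝ) + 1)) ^ (p.1 + 3) * multHarmonic cs M) =
      (1 / ((M : ℝ) + 1)) ^ 3 * elemVal M i * ((1 / ((M : ℝ) + 1)) ^ p.1 *
        PowerSeries.coeff p.2 (PowerSeries.X ^ i * complProd 0 M)) := by
    intro p _
    have h2 := sum_choose_mul_multHarmonic p.2 i M
    calc _ = (1 / ((M : ℝ) + 1)) ^ (p.1 + 3) *
          ∑ cs ∈ compositionLists p.2, (cs.length.choose i : ℝ) * multHarmonic cs M := by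
          rw [mul_sum]
          exact sum_congr rfl fun _ _ => by ring
      _ = _ := by rw [h2]; ring
  -- Summing the excess powers of 1/(M+1) in the first entry supplies the missing geometric factor,
  -- turning h_k(M) into h_k(M+1).
  rw [sum_congr rfl h1, ← mul_sum, sum_antidiagonal_pow_mul_coeff, complVal, complProd_succ,
    Nat.cast_zero, zero_add, mul_left_comm (geomSeries _), PowerSeries.coeff_X_pow_mul', mul_assoc]
  simp

/-! ### The evaluation -/

theorem hasSum_etaTerm_zero (k : ℕ) :
    HasSum (fun M : ℕ => etaTerm [2] (elemSym 0 * complSym k) (M + 1))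
      (((k : ℝ) + 1) * mzv [k + 2]) := by
  have h := hasSum_wzTerm_zero 0 k
  rw [mzv_singleton (by omega)]
  simp only [zero_add, Nat.choose_one_right, Nat.cast_add, Nat.cast_one] at h
  refine h.congr_fun fun M => ?_
  rw [etaTerm_two_elemSym_mul_complSym, wzTerm_zero_left, elemVal_zero_right, elemVal_zero_right]

theorem hasSum_etaTerm_succ (i k : ℕ) :
    HasSum (fun M : ℕ => etaTerm [2] (elemSym (i + 1) * complSym k) (M + 1))
      (∑ p ∈ Icc (i + 1) (i + 1 + k), (((p - 1).choose i : ℕ) : ℝ) * ST (i + 1 + k + 2) p +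
        (((i + 1 + k + 1).choose (i + 1 + 1) : ℕ) : ℝ) * mzv [i + 1 + k + 2]) := by
  rw [mzv_singleton (by omega)]
  refine ((hasSum_sum_ST i k).add (hasSum_wzTerm_zero (i + 1) k)).congr_fun fun M => ?_
  -- The recursion for e_{i+1}(M+1) gives the splitting into the two series already summed.
  rw [etaTerm_two_elemSym_mul_complSym, wzTerm_zero_left, elemVal_succ]
  simp only [shiftSeq]
  field_simp
  ring

end HFun

theorem mainTheorem8 (n j : ℕ) (hj : j ≤ n) :
    Summable (fun m : ℕ => HFun.etaTerm [2] (HFun.elemSym j * HFun.complSym (n - j)) (m + 1)) ∧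
    (j = 0 → HFun.eta [2] (HFun.elemSym j * HFun.complSym (n - j)) = ((n : ℝ) + 1) * HFun.mzv [n + 2]) ∧
    (1 ≤ j → HFun.eta [2] (HFun.elemSym j * HFun.complSym (n - j)) =
      ∑ p ∈ Finset.Icc j n, (((p - 1).choose (j - 1) : ℕ) : ℝ) * HFun.ST (n + 2) p +
        (((n + 1).choose (j + 1) : ℕ) : ℝ) * HFun.mzv [n + 2]) := by
  obtain ⟨k, rfl⟩ := Nat.exists_eq_add_of_le hj
  rw [Nat.add_sub_cancel_left]
  cases j with
  | zero =>
    have h := HFun.hasSum_etaTerm_zero k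
    refine ⟨h.summable, fun _ => ?_, fun h => absurd h (by norm_num)⟩
    rw [zero_add]
    exact h.tsum_eq
  | succ i =>
    have h := HFun.hasSum_etaTerm_succ i k
    exact ⟨h.summable, fun h => absurd h (Nat.succ_ne_zero i), fun _ => h.tsum_eq⟩
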